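/- Let $\mathbb B$ be a relational structure with a finite nonempty domain $B$ (the signature may be infinite). For $n\ge 1$, an $n$-ary polymorphism of $\mathbb B$ is a homomorphism $\mathbb B^n\to\mathbb B$; $\operatorname{Pol}(\mathbb B)$ is the set of all polymorphisms. Suppose that 1. $\mathbb B$ has a quasi Maltsev polymorphism, i.e. a ternary polymorphism $f$ with $f(x,x,x)=f(x,y,y)=f(y,y,x)$ for all $x,y\in B$; and 2. for every $n\ge 1$, $\mathbb B$ has a fully symmetric $n$-ary polymorphism, i.e. an $n$-ary polymorphism $f$ with $f(x_1,\dots,x_n)=f(x_{\pi(1)},\dots,x_{\pi(n)})$ for all $x_1,\dots,x_n\in B$ and all permutations $\pi$ of $\{1,\dots,n\}$. Let $\mathbb P_1$ be the digraph with two vertices and a single directed edge between them. Then $\mathbb B$ is pp-constructable from $\mathbb P_1$, that is, $\mathbb B$ is homomorphically equivalent to a structure whose domain is $P_1^d$ for some $d\ge 1$ and each of whose $k$-ary relations, regarded as a $kd$-ary relation on $P_1$, is definable in $\mathbb P_1$ by a primitive positive formula (a formula built from atomic formulas, equalities and $\bot$ by conjunction and existential quantification). Equivalently, there is a minion homomorphism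 from $\operatorname{Pol}(\mathbb P_1)$ to $\operatorname{Pol}(\mathbb B)$, that is, an arity-preserving map $\xi$ with $\xi(f_\sigma)=\xi(f)_\sigma$ for all $n,m\ge 1$, all $n$-ary $f\in\operatorname{Pol}(\mathbb P_1)$ and all $\sigma\colon\{1,\dots,n\}\to\{1,\dots,m\}$, where $f_\sigma(c_1,\dots,c_m)=f(c_{\sigma(1)},\dots,c_{\sigma(n)})$. -/

import Mathlib

namespace PPConstruct

open scoped FirstOrder

universe u v w u' v' w'

/-! ### Polymorphisms -/

section Polymorphisms

variable (L : FirstOrder.Language.{u, v}) (B : Type w) [L.Structure B]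

/-- The structure `B ^ n`: all symbols are interpreted componentwise. -/
@[reducible]
def powerStructure (n : ℕ) : L.Structure (Fin n → B) where
  funMap F x := fun i => FirstOrder.Language.Structure.funMap F (fun j => x j i)
  RelMap R x := ∀ i, FirstOrder.Language.Structure.RelMap R (fun j => x j i)

/-- The set `Pol(B)⁽ⁿ⁾` of `n`-ary polymorphisms of `B`: the operations `f : Bⁿ → B` that are
homomorphisms from `B ^ n` to `B`. (Only the arities `n ≥ 1` are used.) -/
def Pol (n : ℕ) : Set ((Fin n → B) → B) :=
  letI := powerStructure L B n
  {f | ∃ h : (Fin n → B) →[L] B, ⇑h = f}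

end Polymorphisms

/-! ### Minor conditions and minion homomorphisms -/

/-- The minor `f_σ (c₁, …, c_m) = f (c_{σ 1}, …, c_{σ n})`. -/
def minor {C : Type w} {n m : ℕ} (f : (Fin n → C) → C) (σ : Fin n → Fin m) :
    (Fin m → C) → C :=
  fun c => f (c ∘ σ)

theorem minor_mem_Pol {L : FirstOrder.Language.{u, v}} {B : Type w} [L.Structure B] {n m : ℕ}
    {f : (Fin n → B) → B} (hf : f ∈ Pol L B n) (σ : Fin n → Fin m) :
    minor f σ ∈ Pol L B m := by
  let _ := powerStructure L B n
  let _ := powerStructure L B m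
  obtain ⟨h, rfl⟩ := hf
  exact ⟨{ toFun := minor h σ
           map_fun' := fun F x => h.map_fun F (fun j => x j ∘ σ)
           map_rel' := fun R x hx => h.map_rel R (fun j => x j ∘ σ) (fun i => hx (σ i)) }, rfl⟩

/-- A minor preserving map (minion homomorphism) from `Pol(A)` to `Pol(B)`. -/
structure MinionHom (L : FirstOrder.Language.{u, v}) (A : Type w) [L.Structure A]
    (L' : FirstOrder.Language.{u', v'}) (B : Type w') [L'.Structure B] where
  toFun : ∀ n : ℕ, 0 < n → Pol L A n → Pol L' B n
  map_minor : ∀ (n m : ℕ) (hn : 0 < n) (hm : 0 < m) (f : Pol L A n) (σ : Fin n → Fin m),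
    (toFun m hm ⟨minor f.1 σ, minor_mem_Pol f.2 σ⟩).1 = minor (toFun n hn f).1 σ

/-- `f (x, x, x) = f (x, y, y) = f (y, y, x)` for all `x, y`. -/
def IsQuasiMaltsev {C : Type w} (f : (Fin 3 → C) → C) : Prop :=
  ∀ x y : C, f ![x, x, x] = f ![x, y, y] ∧ f ![x, y, y] = f ![y, y, x]

/-- The value of `f` does not change when its arguments are permuted. -/
def IsFullySymmetric {C : Type w} {n : ℕ} (f : (Fin n → C) → C) : Prop :=
  ∀ (π : Equiv.Perm (Fin n)) (x : Fin n → C), f (x ∘ π) = f x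

/-! ### Primitive positive constructions -/

/-- Primitive positive formulas: built from atomic formulas and `⊥` by conjunction and existential
quantification. -/
inductive IsPP {L : FirstOrder.Language.{u, v}} {α : Type w} :
    ∀ {n : ℕ}, L.BoundedFormula α n → Prop
  | falsum {n : ℕ} : IsPP (⊥ : L.BoundedFormula α n)
  | atomic {n : ℕ} {φ : L.BoundedFormula α n} : φ.IsAtomic → IsPP φ
  | inf {n : ℕ} {φ ψ : L.BoundedFormula α n} : IsPP φ → IsPP ψ → IsPP (φ ⊓ ψ)
  | ex {n : ℕ} {φ : L.BoundedFormula α (n + 1)} : IsPP φ → IsPP φ.ex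

/-- The relation `S`, with coordinates indexed by `α`, is pp-definable in `A` (without
parameters). -/
def PPDefinable (L : FirstOrder.Language.{u, v}) (A : Type w) [L.Structure A] {α : Type w'}
    (S : Set (α → A)) : Prop :=
  ∃ φ : L.Formula α, IsPP φ ∧ S = {x | φ.Realize x}

/-- The given `L'`-structure with domain `A ^ d` is a pp-power of `A`: each of its `k`-ary
relations, regarded as a `k * d`-ary relation on `A`, is pp-definable in `A`. -/
def IsPPPower (L : FirstOrder.Language.{u, v}) (A : Type w) [L.Structure A]
    (L' : FirstOrder.Language.{u', v'}) (d : ℕ) [L'.Structure (Fin d → A)] : Prop :=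
  ∀ (k : ℕ) (R : L'.Relations k),
    PPDefinable L A
      {x : Fin k × Fin d → A |
        FirstOrder.Language.Structure.RelMap R (fun (j : Fin k) (i : Fin d) => x (j, i))}

/-- `A` pp-constructs `B`: for some `d ≥ 1` there is a pp-power of `A` with domain `A ^ d` that is
homomorphically equivalent to `B`. (Closing pp-powers under isomorphism would not change this.) -/
def PPConstructs (L : FirstOrder.Language.{u, v}) [L.IsRelational] (A : Type w) [L.Structure A]
    (L' : FirstOrder.Language.{u', v'}) [L'.IsRelational] (B : Type w') [L'.Structure B] : Prop :=
  ∃ d : ℕ, 0 < d ∧ ∃ _ : L'.Structure (Fin d → A),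
    IsPPPower L A L' d ∧
      Nonempty ((Fin d → A) →[L'] B) ∧ Nonempty (B →[L'] (Fin d → A))

/-! ### The digraph `P₁` -/

/-- The two vertices of the digraph `P₁`. -/
inductive P₁ : Type
  | source
  | target

/-- `P₁` is the digraph (structure with a single binary relation, the symbol being the one of
`Language.graph`) with two vertices whose only edge is `(source, target)`. -/
instance : FirstOrder.Language.graph.Structure P₁ where
  RelMap := fun {n} (R : FirstOrder.Language.graph.Relations n) =>
    match n, R with
    | _, .adj => fun x : Fin 2 → P₁ => x 0 = .source ∧ x 1 = .target

end PPConstruct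

namespace PPConstruct

universe u v w u' v' w'

/-! ### Maltsev algebras with symmetric operations of all arities -/

/-! After composition with suitable endomorphisms, the given polymorphisms take values in a set `A`
and are idempotent there, so `A` is a finite algebra with a Maltsev operation and symmetric
operations of all arities. A Boolean function on the subsets of `A` that is idempotent amounts to a
family of subsets containing `A` but not the empty set. It suffices to choose an element of every
finite algebra with such a family, naturally with respect to homomorphisms that push the families
forward (`IsHom.map_point`). Indeed, a tuple in the hull of a relation `R` puts a family on `R`
itself, and the coordinate projections push it forward to the given families; hence the elements
chosen for the coordinates form a tuple of `R` (`relMap_eval`).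

The choice is by induction on cardinality. If a smaller algebra maps to `X`, the image of its
element is forced, and it is unique because supporting subalgebras are closed under intersection
(`exists_isGood_of_smaller`). Otherwise an element must agree with the ones chosen in all proper
quotients. This is a Chinese remainder problem (`exists_forall_toQuot_eq_point`): congruences
permute by the Maltsev operation and distribute by the symmetric operations (`exists_loop`,
`IsCong.distrib`). Applying a symmetric operation to all automorphic images of a solution makes it
invariant (`exists_fixed_mem`). -/

/-- An algebra with an idempotent Maltsev operation and with idempotent fully symmetric operations
of all positive arities. -/
class SymMaltsev (Q : Type u) where
  p : Q → Q → Q → Q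
  s : ∀ n : ℕ, (Fin (n + 1) → Q) → Q
  p_right : ∀ x y, p x y y = x
  p_left : ∀ x y, p y y x = x
  s_const : ∀ n x, s n (fun _ => x) = x
  s_perm : ∀ n (π : Equiv.Perm (Fin (n + 1))) x, s n (x ∘ π) = s n x

namespace SymMaltsev

variable {Q : Type u} [SymMaltsev Q]

/-- A relation without dead ends on a finite nonempty set that is preserved by the symmetric
operations has a loop. -/
theorem exists_loop [Finite Q] {S : Set Q} (hS : S.Nonempty) {E : Q → Q → Prop}
    (hE : ∀ x ∈ S, ∃ y ∈ S, E x y)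
    (hs : ∀ n (x y : Fin (n + 1) → Q), (∀ i, E (x i) (y i)) → E (s n x) (s n y)) :
    ∃ x, E x x := by
  choose! g hgS hg using hE
  obtain ⟨x₀, hx₀⟩ := hS
  have hit : ∀ n, g^[n] x₀ ∈ S := by
    intro n
    induction n with
    | zero => exact hx₀
    | succ n ih => rw [Function.iterate_succ_apply']; exact hgS _ ih
  obtain ⟨i, j, hij, h⟩ : ∃ i j, i < j ∧ g^[i] x₀ = g^[j] x₀ := by
    obtain ⟨i, j, hne, h⟩ := Finite.exists_ne_map_eq_of_infinite (fun n => g^[n] x₀)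
    rcases lt_or_gt_of_ne hne with hlt | hlt
    · exact ⟨i, j, hlt, h⟩
    · exact ⟨j, i, hlt, h.symm⟩
  obtain ⟨n, rfl⟩ := Nat.exists_eq_add_of_lt hij
  -- These are the vertices of a cycle of length `n + 1`. Rotation carries each vertex to its
  -- successor, so the symmetric value is related to itself.
  let x : Fin (n + 1) → Q := fun k => g^[i + k] x₀
  refine ⟨s n x, ?_⟩
  have key := hs n x (x ∘ finRotate (n + 1)) ?_
  · rwa [s_perm] at key
  intro k
  have hk : g (x k) = (x ∘ finRotate (n + 1)) k := by
    simp only [x, Function.comp]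
    rw [← Function.iterate_succ_apply' g]
    rcases eq_or_ne k (Fin.last n) with rfl | hne
    · rw [finRotate_last]
      simpa [Nat.succ_eq_add_one] using h.symm
    · rw [coe_finRotate_of_ne_last hne]
      rfl
  rw [← hk]
  exact hg _ (hit _)

/-- Congruences. -/
structure IsCong (r : Setoid Q) : Prop where
  p : ∀ {x x' y y' z z'}, r x x' → r y y' → r z z' → r (p x y z) (p x' y' z')
  s : ∀ {n} {x y : Fin (n + 1) → Q}, (∀ i, r (x i) (y i)) → r (s n x) (s n y)

theorem IsCong.inf {α β : Setoid Q} (hα : IsCong α) (hβ : IsCong β) : IsCong (α ⊓ β) where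
  p h₁ h₂ h₃ := ⟨hα.p h₁.1 h₂.1 h₃.1, hβ.p h₁.2 h₂.2 h₃.2⟩
  s h := ⟨hα.s fun i => (h i).1, hβ.s fun i => (h i).2⟩

/-- Maltsev's argument: `p x y z` is `β`-related to `p x y y = x` and `α`-related to `p y y z = z`.
-/
theorem IsCong.comm {α β : Setoid Q} (hα : IsCong α) (hβ : IsCong β) {x z : Q}
    (h : ∃ y, α x y ∧ β y z) : ∃ y, β x y ∧ α y z := by
  obtain ⟨y, hxy, hyz⟩ := h
  refine ⟨SymMaltsev.p x y z, ?_, ?_⟩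
  · have := hβ.p (β.refl x) (β.refl y) (β.symm hyz)
    rw [p_right] at this
    exact β.symm this
  · have := hα.p hxy (α.refl y) (α.refl z)
    rwa [p_left] at this

/-- The composition of two congruences, which is their join. -/
def IsCong.comp {α β : Setoid Q} (hα : IsCong α) (hβ : IsCong β) : Setoid Q where
  r x z := ∃ y, α x y ∧ β y z
  iseqv :=
    { refl := fun x => ⟨x, α.refl x, β.refl x⟩
      symm := fun ⟨y, hxy, hyz⟩ => hβ.comm hα ⟨y, β.symm hyz, α.symm hxy⟩
      trans := by
        rintro x y z ⟨a, hxa, hay⟩ ⟨b, hyb, hbz⟩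
        obtain ⟨c, hac, hcb⟩ := hβ.comm hα ⟨y, hay, hyb⟩
        exact ⟨c, α.trans hxa hac, β.trans hcb hbz⟩ }

theorem IsCong.comp_isCong {α β : Setoid Q} (hα : IsCong α) (hβ : IsCong β) :
    IsCong (hα.comp hβ) where
  p := by
    rintro _ _ _ _ _ _ ⟨a, h₁, h₁'⟩ ⟨b, h₂, h₂'⟩ ⟨c, h₃, h₃'⟩
    exact ⟨_, hα.p h₁ h₂ h₃, hβ.p h₁' h₂' h₃'⟩
  s := by
    intro n x y h
    choose z h₁ h₂ using h
    exact ⟨_, hα.s h₁, hβ.s h₂⟩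

theorem IsCong.left_le_comp {α β : Setoid Q} (hα : IsCong α) (hβ : IsCong β) :
    α ≤ hα.comp hβ := fun {_ y} h => ⟨y, h, β.refl y⟩

theorem IsCong.right_le_comp {α β : Setoid Q} (hα : IsCong α) (hβ : IsCong β) :
    β ≤ hα.comp hβ := fun {x _} h => ⟨x, α.refl x, h⟩

/-- Congruences of finite algebras distribute. -/
theorem IsCong.distrib [Finite Q] {α β γ : Setoid Q} (hα : IsCong α) (hβ : IsCong β)
    (hγ : IsCong γ) {c d : Q} (h₁ : hα.comp hγ c d) (h₂ : hβ.comp hγ c d) :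
    ∃ y z, γ c y ∧ γ z d ∧ α y z ∧ β y z := by
  -- One step of the relation goes by `β` from the `γ`-class of `c` to that of `d` and returns by
  -- `α`. Idempotence keeps both classes closed under `s`, and a loop gives a pair lying in both `α`
  -- and `β`.
  have key := exists_loop (S := {y | γ c y})
    (E := fun y y₂ => γ c y ∧ ∃ z, γ z d ∧ β y z ∧ α z y₂) ⟨c, γ.refl c⟩ ?_ ?_
  · obtain ⟨y, hcy, z, hzd, hyz, hzy⟩ := key
    exact ⟨y, z, hcy, hzd, α.symm hzy, hyz⟩
  · intro y hcy
    have hyd : hβ.comp hγ y d :=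
      (hβ.comp hγ).trans ((hβ.comp hγ).symm (hβ.right_le_comp hγ hcy)) h₂
    obtain ⟨z, hyz, hzd⟩ := hyd
    have hzc : hα.comp hγ z c :=
      (hα.comp hγ).trans (hα.right_le_comp hγ hzd) ((hα.comp hγ).symm h₁)
    obtain ⟨y₂, hzy, hyc⟩ := hzc
    exact ⟨y₂, γ.symm hyc, hcy, z, hzd, hyz, hzy⟩
  · intro n x y h
    choose hc z hz hxz hzy using h
    refine ⟨?_, SymMaltsev.s n z, ?_, hβ.s hxz, hα.s hzy⟩
    · simpa only [s_const] using hγ.s (x := fun _ => c) hc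
    · simpa only [s_const] using hγ.s (y := fun _ => d) hz

/-- The quotient by a congruence. -/
@[reducible]
noncomputable def IsCong.quotient {r : Setoid Q} (_ : IsCong r) : SymMaltsev (Quotient r) where
  p x y z := ⟦SymMaltsev.p x.out y.out z.out⟧
  s n x := ⟦SymMaltsev.s n fun i => (x i).out⟧
  p_right x y := by rw [p_right, Quotient.out_eq]
  p_left x y := by rw [p_left, Quotient.out_eq]
  s_const n x := by rw [s_const, Quotient.out_eq]
  s_perm n π x := congrArg _ (s_perm n π fun i => (x i).out)

end SymMaltsev

/-! ### Algebras with a family of subsets -/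

open SymMaltsev

/-- A finite algebra with a family of subsets (an idempotent Boolean function whose arguments are
indexed by the algebra). -/
structure FamAlg : Type (u + 1) where
  carrier : Type u
  [alg : SymMaltsev carrier]
  [fin : Finite carrier]
  fam : Set (Set carrier)
  empty_notMem : ∅ ∉ fam
  univ_mem : Set.univ ∈ fam

namespace FamAlg

instance : CoeSort FamAlg.{u} (Type u) := ⟨carrier⟩
instance (X : FamAlg.{u}) : SymMaltsev X := X.alg
instance (X : FamAlg.{u}) : Finite X := X.fin

instance (X : FamAlg.{u}) : Nonempty X := by
  by_contra h
  rw [not_nonempty_iff] at h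
  exact X.empty_notMem (Set.univ_eq_empty_iff.2 h ▸ X.univ_mem)

/-- Homomorphisms that push the family of the domain forward to that of the codomain. -/
structure IsHom {X Y : FamAlg.{u}} (f : X → Y) : Prop where
  map_p : ∀ x y z, f (p x y z) = p (f x) (f y) (f z)
  map_s : ∀ n x, f (s n x) = s n (f ∘ x)
  map_fam : ∀ T, T ∈ Y.fam ↔ f ⁻¹' T ∈ X.fam

variable {X Y Z : FamAlg.{u}}

theorem IsHom.id (X : FamAlg.{u}) : IsHom (id : X → X) :=
  ⟨fun _ _ _ => rfl, fun _ _ => rfl, fun _ => Iff.rfl⟩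

theorem IsHom.comp {g : Y → Z} {f : X → Y} (hg : IsHom g) (hf : IsHom f) : IsHom (g ∘ f) where
  map_p x y z := by simp [hf.map_p, hg.map_p]
  map_s n x := by simp [hf.map_s, hg.map_s, Function.comp_assoc]
  map_fam T := by rw [hg.map_fam, hf.map_fam, Set.preimage_comp]

theorem IsHom.of_comp_surjective {g : Y → Z} {f : X → Y} (hf : IsHom f)
    (hs : Function.Surjective f) (h : IsHom (g ∘ f)) : IsHom g where
  map_p x y z := by
    obtain ⟨x, rfl⟩ := hs x
    obtain ⟨y, rfl⟩ := hs y
    obtain ⟨z, rfl⟩ := hs z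
    rw [← hf.map_p]
    exact h.map_p x y z
  map_s n x := by
    obtain ⟨x, rfl⟩ : ∃ x', x = f ∘ x' := by
      choose x' hx' using fun i => hs (x i)
      exact ⟨x', funext fun i => (hx' i).symm⟩
    rw [← hf.map_s]
    exact h.map_s n x
  map_fam T := by rw [h.map_fam, hf.map_fam, Set.preimage_comp]

theorem IsHom.of_injective_comp {g : Y → Z} {f : X → Y} (hg : IsHom g)
    (hi : Function.Injective g) (h : IsHom (g ∘ f)) : IsHom f where
  map_p x y z := hi (by rw [hg.map_p]; exact h.map_p x y z)
  map_s n x := hi (by rw [hg.map_s]; exact h.map_s n x)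
  map_fam T := by
    rw [← Set.preimage_image_eq T hi, ← hg.map_fam, h.map_fam, Set.preimage_comp]

theorem IsHom.exists_inverse {f : X → Y} (hf : IsHom f) (hb : Function.Bijective f) :
    ∃ g : Y → X, IsHom g ∧ Function.Bijective g ∧ (∀ x, g (f x) = x) ∧ ∀ y, f (g y) = y := by
  let e := Equiv.ofBijective f hb
  refine ⟨e.symm, hf.of_comp_surjective hb.2 ?_, e.symm.bijective, e.symm_apply_apply,
    e.apply_symm_apply⟩
  have : e.symm ∘ f = _root_.id := funext e.symm_apply_apply
  rw [this]
  exact IsHom.id X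

theorem IsHom.ker_isCong {f : X → Y} (hf : IsHom f) : IsCong (Setoid.ker f) where
  p h₁ h₂ h₃ := by
    rw [Setoid.ker_def] at *
    rw [hf.map_p, hf.map_p, h₁, h₂, h₃]
  s h := by
    rw [Setoid.ker_def, hf.map_s, hf.map_s]
    exact congrArg _ (funext h)

/-- The quotient by a congruence, with the image family. -/
noncomputable def quot (X : FamAlg.{u}) {r : Setoid X} (hr : IsCong r) : FamAlg.{u} :=
  letI := hr.quotient
  { carrier := Quotient r
    fam := {T | Quotient.mk r ⁻¹' T ∈ X.fam}
    empty_notMem := X.empty_notMem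
    univ_mem := X.univ_mem }

/-- The quotient map. -/
def toQuot {r : Setoid X} (hr : IsCong r) : X → X.quot hr := Quotient.mk r

theorem toQuot_surjective {r : Setoid X} (hr : IsCong r) : Function.Surjective (toQuot hr) :=
  Quotient.mk_surjective

theorem toQuot_eq {r : Setoid X} (hr : IsCong r) {x y : X} :
    toQuot hr x = toQuot hr y ↔ r x y := Quotient.eq

theorem isHom_toQuot {r : Setoid X} (hr : IsCong r) : IsHom (toQuot hr) where
  map_p x y z := (toQuot_eq hr).2
    (hr.p (r.symm (Quotient.mk_out x)) (r.symm (Quotient.mk_out y)) (r.symm (Quotient.mk_out z)))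
  map_s _ x := (toQuot_eq hr).2 (hr.s fun i => r.symm (Quotient.mk_out (x i)))
  map_fam _ := Iff.rfl

theorem IsHom.exists_lift {r : Setoid X} (hr : IsCong r) {f : X → Y} (hf : IsHom f)
    (h : r ≤ Setoid.ker f) : ∃ g : X.quot hr → Y, IsHom g ∧ ∀ x, g (toQuot hr x) = f x :=
  ⟨Quotient.lift f fun _ _ hxy => h hxy,
    (isHom_toQuot hr).of_comp_surjective (toQuot_surjective hr) hf, fun _ => rfl⟩

theorem card_quot_lt {r : Setoid X} (hr : IsCong r) (h : r ≠ ⊥) :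
    Nat.card (X.quot hr) < Nat.card X := by
  by_contra hle
  have hb := (toQuot_surjective hr).bijective_of_nat_card_le (not_lt.1 hle)
  refine h (Setoid.ext fun x y => ⟨fun hxy => hb.1 ((toQuot_eq hr).2 hxy), ?_⟩)
  rintro rfl
  exact r.refl x

/-- A subset `S` supports `X` if it is a subalgebra on which the family lives. -/
structure Supports (X : FamAlg.{u}) (S : Set X) : Prop where
  p : ∀ x ∈ S, ∀ y ∈ S, ∀ z ∈ S, p x y z ∈ S
  s : ∀ n (x : Fin (n + 1) → X), (∀ i, x i ∈ S) → s n x ∈ S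
  fam : ∀ T, T ∈ X.fam ↔ S ∩ T ∈ X.fam

/-- The subalgebra on a supporting set. -/
def sub (X : FamAlg.{u}) {S : Set X} (hS : X.Supports S) : FamAlg.{u} :=
  letI : SymMaltsev S :=
    { p := fun x y z => ⟨SymMaltsev.p x.1 y.1 z.1, hS.p _ x.2 _ y.2 _ z.2⟩
      s := fun n x => ⟨SymMaltsev.s n fun i => (x i).1, hS.s n _ fun i => (x i).2⟩
      p_right := fun x y => Subtype.ext (p_right _ _)
      p_left := fun x y => Subtype.ext (p_left _ _)
      s_const := fun n x => Subtype.ext (s_const _ _)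
      s_perm := fun n π x => Subtype.ext (s_perm n π fun i => (x i).1) }
  { carrier := S
    fam := {T | Subtype.val '' T ∈ X.fam}
    empty_notMem := by simpa using X.empty_notMem
    univ_mem := by simpa using (hS.fam _).1 X.univ_mem }

theorem Supports.exists_hom {S : Set X} (hS : X.Supports S) :
    ∃ (Y : FamAlg.{u}) (f : Y → X), IsHom f ∧ Function.Injective f ∧ Set.range f = S :=
  ⟨X.sub hS, Subtype.val,
    ⟨fun _ _ _ => rfl, fun _ _ => rfl, fun T => by
      rw [hS.fam, ← Subtype.image_preimage_coe]; rfl⟩,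
    Subtype.val_injective, Subtype.range_coe⟩

theorem IsHom.supports_range {f : Y → X} (hf : IsHom f) : X.Supports (Set.range f) where
  p := by
    rintro _ ⟨x, rfl⟩ _ ⟨y, rfl⟩ _ ⟨z, rfl⟩
    exact ⟨_, hf.map_p x y z⟩
  s n x h := by
    choose y hy using h
    exact ⟨_, (hf.map_s n y).trans (congrArg _ (funext hy))⟩
  fam T := by rw [hf.map_fam, hf.map_fam, Set.preimage_range_inter]

/-- The intersection is automatically nonempty, since the empty set is not in the family. -/
theorem Supports.inter {S T : Set X} (hS : X.Supports S) (hT : X.Supports T) :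
    X.Supports (S ∩ T) where
  p x hx y hy z hz := ⟨hS.p x hx.1 y hy.1 z hz.1, hT.p x hx.2 y hy.2 z hz.2⟩
  s n x h := ⟨hS.s n x fun i => (h i).1, hT.s n x fun i => (h i).2⟩
  fam U := by rw [hT.fam, hS.fam, Set.inter_assoc]

theorem exists_hom_factor {f : Y → X} {i : Z → X} (hf : IsHom f) (hi : IsHom i)
    (hinj : Function.Injective i) (h : Set.range f ⊆ Set.range i) :
    ∃ g : Y → Z, IsHom g ∧ ∀ y, i (g y) = f y := by
  choose g hg using fun y => h ⟨y, rfl⟩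
  refine ⟨g, hi.of_injective_comp hinj ?_, hg⟩
  have : i ∘ g = f := funext hg
  rwa [this]

/-! ### A natural choice of points -/

/-- Isomorphism of algebras with a family. -/
def isoSetoid : Setoid FamAlg.{u} where
  r X Y := ∃ f : X → Y, IsHom f ∧ Function.Bijective f
  iseqv :=
    { refl := fun X => ⟨id, IsHom.id X, Function.bijective_id⟩
      symm := fun ⟨_, hf, hb⟩ => let ⟨g, hg, hgb, _⟩ := hf.exists_inverse hb; ⟨g, hg, hgb⟩
      trans := fun ⟨_, hf, hb⟩ ⟨_, hg, hgb⟩ => ⟨_, hg.comp hf, hgb.comp hb⟩ }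

/-- The chosen representative of the isomorphism class. -/
noncomputable def rep (X : FamAlg.{u}) : FamAlg.{u} := (Quotient.mk isoSetoid X).out

theorem exists_rep_iso (X : FamAlg.{u}) : ∃ f : X.rep → X, IsHom f ∧ Function.Bijective f :=
  isoSetoid.trans (isoSetoid.refl _) (Quotient.mk_out (s := isoSetoid) X)

theorem rep_eq (h : ∃ f : X → Y, IsHom f ∧ Function.Bijective f) : X.rep = Y.rep :=
  congrArg Quotient.out (Quotient.sound (s := isoSetoid) h)

/-- An isomorphism from the representative. -/
noncomputable def repIso (X : FamAlg.{u}) : X.rep → X := X.exists_rep_iso.choose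

theorem isHom_repIso (X : FamAlg.{u}) : IsHom X.repIso := X.exists_rep_iso.choose_spec.1

theorem repIso_bijective (X : FamAlg.{u}) : Function.Bijective X.repIso :=
  X.exists_rep_iso.choose_spec.2

theorem card_rep (X : FamAlg.{u}) : Nat.card X.rep = Nat.card X :=
  Nat.card_eq_of_bijective _ X.repIso_bijective

/-- The element `c` of `X` is compatible with the choice `h` of elements of the smaller algebras
and invariant under automorphisms. -/
structure IsGood (X : FamAlg.{u}) (h : ∀ Y : FamAlg.{u}, Nat.card Y < Nat.card X → Y) (c : X) :
    Prop where
  to_smaller : ∀ (Y : FamAlg.{u}) hY (f : X → Y), IsHom f → f c = h Y hY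
  of_smaller : ∀ (Y : FamAlg.{u}) hY (f : Y → X), IsHom f → f (h Y hY) = c
  auto : ∀ f : X → X, IsHom f → Function.Bijective f → f c = c

/-- A choice of an element of each algebra with a family that is natural, see
`IsHom.map_point`. -/
noncomputable def point (X : FamAlg.{u}) : X :=
  -- Choosing on the representative lets isomorphic algebras share one choice. The isomorphism used
  -- for transport is irrelevant once the element is fixed by automorphisms.
  X.repIso (Classical.epsilon (X.rep.IsGood fun Y _ => point Y))
termination_by Nat.card X
decreasing_by
  rename_i h
  rwa [card_rep] at h

/-- The chosen element of a representative. -/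
noncomputable def basePoint (X : FamAlg.{u}) : X :=
  Classical.epsilon (X.IsGood fun Y _ => point Y)

theorem point_eq (X : FamAlg.{u}) : X.point = X.repIso X.rep.basePoint := by
  rw [point, basePoint]

theorem IsGood.map {h : ∀ Y : FamAlg.{u}, Y} {c : X} (hc : X.IsGood (fun Z _ => h Z) c)
    {e : X → Y} (he : IsHom e) (hb : Function.Bijective e) : Y.IsGood (fun Z _ => h Z) (e c) := by
  obtain ⟨e', he', hb', hl, hr⟩ := he.exists_inverse hb
  have hcard : Nat.card X = Nat.card Y := Nat.card_eq_of_bijective e hb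
  refine ⟨fun Z hZ f hf => hc.to_smaller Z (hcard ▸ hZ) (f ∘ e) (hf.comp he), fun Z hZ f hf => ?_,
    fun f hf hfb => ?_⟩
  · rw [← hc.of_smaller Z (hcard ▸ hZ) (e' ∘ f) (he'.comp hf)]
    exact (hr _).symm
  · have := hc.auto (e' ∘ f ∘ e) (he'.comp (hf.comp he)) (hb'.comp (hfb.comp hb))
    simp only [Function.comp] at this
    rw [← hr (f (e c)), this]

theorem isGood_point_of_exists (h : ∃ c, X.IsGood (fun Y _ => point Y) c) :
    X.IsGood (fun Y _ => point Y) X.point := by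
  obtain ⟨c, hc⟩ := h
  obtain ⟨g, hg, hgb, -⟩ := X.isHom_repIso.exists_inverse X.repIso_bijective
  rw [point_eq]
  exact (Classical.epsilon_spec (p := X.rep.IsGood fun Y _ => point Y)
    ⟨_, hc.map hg hgb⟩).map X.isHom_repIso X.repIso_bijective

/-- Both points come from the same element of the common representative, so they can differ only by
an automorphism, which fixes a good element. -/
theorem map_point_of_bijective {f : X → Y} (hf : IsHom f) (hb : Function.Bijective f)
    (hX : X.IsGood (fun Y _ => point Y) X.point) : f X.point = Y.point := by
  obtain ⟨e, he, heb, hpt⟩ : ∃ e : X.rep → Y, IsHom e ∧ Function.Bijective e ∧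
      Y.point = e X.rep.basePoint := by
    rw [rep_eq ⟨f, hf, hb⟩]
    exact ⟨_, Y.isHom_repIso, Y.repIso_bijective, Y.point_eq⟩
  obtain ⟨g, hg, hgb, hgl, -⟩ := X.isHom_repIso.exists_inverse X.repIso_bijective
  obtain ⟨f', hf', hfb', -, hfr⟩ := hf.exists_inverse hb
  have h := hX.auto (f' ∘ e ∘ g) (hf'.comp (he.comp hg)) (hfb'.comp (heb.comp hgb))
  rw [hpt, ← h]
  simp only [Function.comp, hfr]
  rw [X.point_eq, hgl]

/-- Factor `f` through the quotient by its kernel: the surjective part is covered by `to_smaller`,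
the injective part by `of_smaller` or by the bijective case. -/
theorem map_point_of_isGood {f : X → Y} (hf : IsHom f)
    (hX : X.IsGood (fun Y _ => point Y) X.point) (hY : Y.IsGood (fun Y _ => point Y) Y.point)
    (hq : ∀ {r : Setoid X} (hr : IsCong r), r ≠ ⊥ →
      (X.quot hr).IsGood (fun Y _ => point Y) (X.quot hr).point) : f X.point = Y.point := by
  have inj : ∀ {X : FamAlg.{u}} {f : X → Y}, IsHom f → X.IsGood (fun Y _ => point Y) X.point →
      Function.Injective f → f X.point = Y.point := by
    intro X f hf hX hi
    by_cases hlt : Nat.card X < Nat.card Y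
    · exact hY.of_smaller X hlt f hf
    · exact map_point_of_bijective hf (hi.bijective_of_nat_card_le (not_lt.1 hlt)) hX
  by_cases hi : Function.Injective f
  · exact inj hf hX hi
  have hr : Setoid.ker f ≠ ⊥ := fun h => hi (Setoid.ker_eq_bot_iff.1 h)
  have hc := hf.ker_isCong
  obtain ⟨g, hg, hgf⟩ := hf.exists_lift hc le_rfl
  rw [← hgf, hX.to_smaller _ (card_quot_lt hc hr) _ (isHom_toQuot hc)]
  refine inj hg (hq hc hr) fun a b hab => ?_
  obtain ⟨a, rfl⟩ := toQuot_surjective hc a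
  obtain ⟨b, rfl⟩ := toQuot_surjective hc b
  rw [hgf, hgf] at hab
  exact (toQuot_eq hc).2 hab

/-- The automorphisms fix an element of each invariant subalgebra. -/
theorem exists_fixed_mem {C : Set X} (hC : C.Nonempty)
    (hs : ∀ n (x : Fin (n + 1) → X), (∀ i, x i ∈ C) → s n x ∈ C)
    (ha : ∀ f : X → X, IsHom f → Function.Bijective f → ∀ c ∈ C, f c ∈ C) :
    ∃ c ∈ C, ∀ f : X → X, IsHom f → Function.Bijective f → f c = c := by
  obtain ⟨c, hc⟩ := hC
  let Γ := {f : X → X // IsHom f ∧ Function.Bijective f}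
  have : Nonempty Γ := ⟨⟨id, IsHom.id X, Function.bijective_id⟩⟩
  obtain ⟨n, ⟨e⟩⟩ := Finite.exists_equiv_fin Γ
  obtain _ | n := n
  · exact (e (Classical.arbitrary Γ)).elim0
  -- The images of `c` under all automorphisms, with repetitions; applying an automorphism only
  -- permutes this list.
  let x : Fin (n + 1) → X := fun i => (e.symm i).1 c
  refine ⟨s n x, hs n x fun i => ha _ (e.symm i).2.1 (e.symm i).2.2 c hc, fun f hf hb => ?_⟩
  let m : Γ → Γ := fun g => ⟨f ∘ g.1, hf.comp g.2.1, hb.comp g.2.2⟩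
  have hm : Function.Bijective m := by
    refine Finite.injective_iff_bijective.1 fun g g' h => Subtype.ext (funext fun y => hb.1 ?_)
    exact congrFun (congrArg Subtype.val h) y
  let π : Equiv.Perm (Fin (n + 1)) := (e.symm.trans (Equiv.ofBijective m hm)).trans e
  have hx : f ∘ x = x ∘ π := by
    funext i
    simp [x, π, m]
  rw [hf.map_s, hx, s_perm]

/-! ### Inductive step: existence of a good element -/

section Step

variable (hnat : ∀ Y Z : FamAlg.{u}, Nat.card Y < Nat.card X → Nat.card Z < Nat.card X →
  ∀ f : Y → Z, IsHom f → f Y.point = Z.point)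

include hnat

/-- Images of two smaller algebras meet in a supporting subalgebra, and naturality below `X`
identifies both candidate elements with the point of that intersection. -/
theorem exists_isGood_of_smaller {f₀ : Y → X} (hf₀ : IsHom f₀) (hY : Nat.card Y < Nat.card X) :
    ∃ c, X.IsGood (fun Y _ => point Y) c := by
  have hsmall : ∀ (Z : FamAlg.{u}) (f : Z → X), IsHom f → Nat.card Z < Nat.card X →
      f Z.point = f₀ Y.point := by
    intro Z f hf hZ
    obtain ⟨I, i, hi, hinj, hI⟩ := hf.supports_range.exists_hom
    obtain ⟨I₀, i₀, hi₀, hinj₀, hI₀⟩ := hf₀.supports_range.exists_hom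
    obtain ⟨J, j, hj, hinjJ, hJ⟩ := (hf.supports_range.inter hf₀.supports_range).exists_hom
    obtain ⟨a, ha, hai⟩ := exists_hom_factor hf hi hinj hI.ge
    obtain ⟨a₀, ha₀, hai₀⟩ := exists_hom_factor hf₀ hi₀ hinj₀ hI₀.ge
    obtain ⟨b, hb, hbi⟩ := exists_hom_factor hj hi hinj
      (hJ.le.trans (Set.inter_subset_left.trans hI.ge))
    obtain ⟨b₀, hb₀, hbi₀⟩ := exists_hom_factor hj hi₀ hinj₀
      (hJ.le.trans (Set.inter_subset_right.trans hI₀.ge))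
    have hcard : ∀ {Z I : FamAlg.{u}} {f : Z → X} {i : I → X}, Function.Injective i →
        Set.range i = Set.range f → Nat.card Z < Nat.card X → Nat.card I < Nat.card X := by
      intro Z I f i hinj hI hZ
      refine lt_of_le_of_lt ?_ hZ
      rw [← Nat.card_range_of_injective hinj, hI]
      exact Finite.card_range_le f
    have hIX := hcard hinj hI hZ
    have hIX₀ := hcard hinj₀ hI₀ hY
    have hbinj : Function.Injective b := fun x y hxy => hinjJ (by rw [← hbi, ← hbi, hxy])
    have hJX := (Nat.card_le_card_of_injective b hbinj).trans_lt hIX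
    rw [← hai, ← hai₀, hnat _ _ hZ hIX a ha, hnat _ _ hY hIX₀ a₀ ha₀,
      ← hnat _ _ hJX hIX b hb, ← hnat _ _ hJX hIX₀ b₀ hb₀, hbi, hbi₀]
  exact ⟨f₀ Y.point, fun Z hZ f hf => hnat Y Z hY hZ (f ∘ f₀) (hf.comp hf₀),
    fun Z hZ f hf => hsmall Z f hf hZ, fun f hf _ => hsmall Y (f ∘ f₀) (hf.comp hf₀) hY⟩

theorem toQuot_eq_point_of_le {r t : Setoid X} (hr : IsCong r) (ht : IsCong t) (hrt : r ≤ t)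
    (hne : r ≠ ⊥) {x : X} (hx : toQuot hr x = (X.quot hr).point) :
    toQuot ht x = (X.quot ht).point := by
  have hne' : t ≠ ⊥ := fun h => hne (le_bot_iff.1 (h ▸ hrt))
  obtain ⟨g, hg, hgf⟩ := (isHom_toQuot ht).exists_lift hr fun {_ _} h => (toQuot_eq ht).2 (hrt h)
  rw [← hgf, hx]
  exact hnat _ _ (card_quot_lt hr hne) (card_quot_lt ht hne') g hg

/-- The Chinese remainder theorem for the system given by the points of the proper quotients. -/
theorem exists_forall_toQuot_eq_point :
    ∃ x : X, ∀ {r : Setoid X} (hr : IsCong r), r ≠ ⊥ → toQuot hr x = (X.quot hr).point := by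
  by_cases hN : ∃ r : Setoid X, IsCong r ∧ r ≠ ⊥
  swap
  · exact ⟨Classical.arbitrary X, fun {r} hr hne => (hN ⟨r, hr, hne⟩).elim⟩
  have : Finite (Setoid X) := Finite.of_injective (fun r : Setoid X => (r : X → X → Prop))
    fun r t h => Setoid.ext fun a b => iff_of_eq (congrFun (congrFun h a) b)
  obtain ⟨μ, ⟨hμ, hμne⟩, hmin⟩ :=
    Set.Finite.exists_minimal (Set.toFinite {r : Setoid X | IsCong r ∧ r ≠ ⊥}) hN
  by_cases hle : ∀ r : Setoid X, IsCong r → r ≠ ⊥ → μ ≤ r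
  · obtain ⟨x, hx⟩ := toQuot_surjective hμ (X.quot hμ).point
    exact ⟨x, fun {r} hr hne => toQuot_eq_point_of_le hnat hμ hr (hle r hr hne) hμne hx⟩
  push Not at hle
  obtain ⟨α, hα, hαne, hμα⟩ := hle
  have hinf : μ ⊓ α = ⊥ := by
    by_contra hne
    exact hμα ((hmin ⟨hμ.inf hα, hne⟩ inf_le_left).trans inf_le_right)
  have hjoin : ∀ {r t : Setoid X} (hr : IsCong r) (ht : IsCong t), r ≠ ⊥ → t ≠ ⊥ → ∀ {x y},
      toQuot hr x = (X.quot hr).point → toQuot ht y = (X.quot ht).point → hr.comp ht x y := by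
    intro r t hr ht hrne htne x y hx hy
    have hc := hr.comp_isCong ht
    rw [← toQuot_eq hc, toQuot_eq_point_of_le hnat hr hc (hr.left_le_comp ht) hrne hx,
      toQuot_eq_point_of_le hnat ht hc (hr.right_le_comp ht) htne hy]
  obtain ⟨y, hy⟩ := toQuot_surjective hμ (X.quot hμ).point
  obtain ⟨z, hz⟩ := toQuot_surjective hα (X.quot hα).point
  obtain ⟨x, hyx, hxz⟩ := hjoin hμ hα hμne hαne hy hz
  rw [(toQuot_eq hμ).2 hyx] at hy
  rw [← (toQuot_eq hα).2 hxz] at hz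
  refine ⟨x, fun {r} hr hne => ?_⟩
  obtain ⟨d, hd⟩ := toQuot_surjective hr (X.quot hr).point
  -- `x` solves the system for `μ` and `α` only. Distributivity links `x` to `d` by `r`, then `μ ⊓ α
  -- = ⊥`, then `r`, so `x` solves it for `r` too.
  obtain ⟨a, b, hxa, hbd, hab, hab'⟩ :=
    hμ.distrib hα hr (hjoin hμ hr hμne hne hy hd) (hjoin hα hr hαne hne hz hd)
  obtain rfl : a = b := by
    have : (μ ⊓ α) a b := ⟨hab, hab'⟩
    rwa [hinf] at this
  rw [← hd]
  exact (toQuot_eq hr).2 (r.trans hxa hbd)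

theorem exists_isGood : ∃ c, X.IsGood (fun Y _ => point Y) c := by
  by_cases hsub : ∃ (Y : FamAlg.{u}) (f : Y → X), IsHom f ∧ Nat.card Y < Nat.card X
  · obtain ⟨Y, f, hf, hY⟩ := hsub
    exact exists_isGood_of_smaller hnat hf hY
  let C : Set X := {x | ∀ Y : FamAlg.{u}, Nat.card Y < Nat.card X → ∀ f : X → Y, IsHom f →
    f x = Y.point}
  have hC : C.Nonempty := by
    obtain ⟨x, hx⟩ := exists_forall_toQuot_eq_point hnat
    refine ⟨x, fun Y hY f hf => ?_⟩
    have hr := hf.ker_isCong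
    have hne : Setoid.ker f ≠ ⊥ := fun h =>
      hY.not_ge (Nat.card_le_card_of_injective f (Setoid.ker_eq_bot_iff.1 h))
    obtain ⟨g, hg, hgf⟩ := hf.exists_lift hr le_rfl
    rw [← hgf, hx hr hne]
    exact hnat _ _ (card_quot_lt hr hne) hY g hg
  have hs : ∀ n (x : Fin (n + 1) → X), (∀ i, x i ∈ C) → s n x ∈ C := by
    intro n x hx Y hY f hf
    rw [hf.map_s]
    have : f ∘ x = fun _ => Y.point := funext fun i => hx i Y hY f hf
    rw [this, s_const]
  obtain ⟨c, hc, hfix⟩ := exists_fixed_mem hC hs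
    fun g hg _ c hc Y hY f hf => hc Y hY (f ∘ g) (hf.comp hg)
  exact ⟨c, hc, fun Y hY f hf => (hsub ⟨Y, f, hf, hY⟩).elim, hfix⟩

end Step

theorem isGood_point (X : FamAlg.{u}) : X.IsGood (fun Y _ => point Y) X.point := by
  suffices ∀ n, ∀ X : FamAlg.{u}, Nat.card X = n → X.IsGood (fun Y _ => point Y) X.point from
    this _ X rfl
  intro n
  induction n using Nat.strong_induction_on with
  | _ n ih =>
    rintro X rfl
    exact isGood_point_of_exists (exists_isGood fun Y Z hY hZ f hf =>
      map_point_of_isGood hf (ih _ hY _ rfl) (ih _ hZ _ rfl)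
        fun hr hne => ih _ ((card_quot_lt hr hne).trans hY) _ rfl)

theorem IsHom.map_point {f : X → Y} (hf : IsHom f) : f X.point = Y.point :=
  map_point_of_isGood hf X.isGood_point Y.isGood_point fun _ _ => isGood_point _

end FamAlg

/-! ### Reduction to idempotent polymorphisms -/

section Core

variable {L : FirstOrder.Language.{u, v}} {B : Type w} [L.Structure B]

open FirstOrder.Language.Structure (RelMap)

theorem mem_Pol_iff [L.IsRelational] {n : ℕ} {f : (Fin n → B) → B} :
    f ∈ Pol L B n ↔ ∀ (k : ℕ) (R : L.Relations k) (x : Fin k → Fin n → B),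
      (∀ i, RelMap R fun j => x j i) → RelMap R fun j => f (x j) := by
  let _ := powerStructure L B n
  constructor
  · rintro ⟨h, rfl⟩ k R x hx
    exact h.map_rel R x hx
  · intro hf
    exact ⟨{ toFun := f
             map_fun' := fun F => isEmptyElim F
             map_rel' := fun R x hx => hf _ R x hx }, rfl⟩

variable (L) in
/-- Unary operations that preserve all relations. -/
def IsEndo (g : B → B) : Prop :=
  ∀ (k : ℕ) (R : L.Relations k) (x : Fin k → B), RelMap R x → RelMap R (g ∘ x)

theorem IsEndo.comp {g h : B → B} (hg : IsEndo L g) (hh : IsEndo L h) : IsEndo L (g ∘ h) :=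
  fun k R x hx => hg k R _ (hh k R x hx)

theorem isEndo_id : IsEndo L (id : B → B) := fun _ _ _ hx => hx

theorem IsEndo.iterate {g : B → B} (hg : IsEndo L g) (m : ℕ) : IsEndo L g^[m] := by
  induction m with
  | zero => exact isEndo_id
  | succ m ih => exact ih.comp hg

theorem IsEndo.comp_mem_Pol [L.IsRelational] {g : B → B} (hg : IsEndo L g) {n : ℕ}
    {f : (Fin n → B) → B} (hf : f ∈ Pol L B n) : g ∘ f ∈ Pol L B n :=
  mem_Pol_iff.2 fun k R x hx => hg k R _ (mem_Pol_iff.1 hf k R x hx)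

theorem isEndo_diag [L.IsRelational] {n : ℕ} {f : (Fin n → B) → B} (hf : f ∈ Pol L B n) :
    IsEndo L fun b => f fun _ => b :=
  fun k R x hx => mem_Pol_iff.1 hf k R (fun j _ => x j) fun _ => hx

variable (L B) in
/-- On the image of an endomorphism with minimal image every endomorphism is left invertible. -/
theorem exists_core [Finite B] [Nonempty B] :
    ∃ A : Set B, A.Nonempty ∧ ∀ v : B → B, IsEndo L v →
      ∃ u : B → B, IsEndo L u ∧ (∀ b, u b ∈ A) ∧ ∀ a ∈ A, u (v a) = a := by
  obtain ⟨e, he, hmin⟩ := (Set.toFinite {g : B → B | IsEndo L g}).exists_minimalFor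
    (fun g => (Set.range g).ncard) _ ⟨id, isEndo_id⟩
  refine ⟨Set.range e, Set.range_nonempty e, fun v hv => ?_⟩
  -- By minimality `e ∘ v` permutes the image of `e`. Some positive power is the identity there, and
  -- the power just before it provides the left inverse of `v`.
  let t : Set.range e → Set.range e := fun a => ⟨e (v a), Set.mem_range_self _⟩
  have ht : Function.Surjective t := by
    have hsub : Set.range (e ∘ v ∘ e) ⊆ Set.range e := Set.range_comp_subset_range _ _
    have heq : Set.range (e ∘ v ∘ e) = Set.range e := by
      refine Set.eq_of_subset_of_ncard_le hsub ?_
      exact hmin (he.comp (hv.comp he)) (Set.ncard_le_ncard hsub)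
    rintro ⟨a, ha⟩
    obtain ⟨b, hb⟩ := heq.ge ha
    exact ⟨⟨e b, Set.mem_range_self b⟩, Subtype.ext hb⟩
  let σ : Equiv.Perm (Set.range e) := Equiv.ofBijective t (Finite.surjective_iff_bijective.1 ht)
  have hit : ∀ (m : ℕ) (a : Set.range e), (e ∘ v)^[m] (a : B) = ((σ ^ m) a : Set.range e) := by
    intro m
    induction m with
    | zero => intro a; rfl
    | succ m ih =>
      intro a
      rw [Function.iterate_succ_apply, pow_succ, Equiv.Perm.mul_apply, ← ih]
      rfl
  obtain ⟨m, hm⟩ : ∃ m, σ ^ (m + 1) = 1 := by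
    obtain ⟨k, hk, h⟩ := (isOfFinOrder_of_finite σ).exists_pow_eq_one
    exact ⟨k - 1, by rwa [Nat.sub_add_cancel hk]⟩
  refine ⟨(e ∘ v)^[m] ∘ e, ((he.comp hv).iterate m).comp he, fun b => ?_, fun a ha => ?_⟩
  · simp only [Function.comp_apply]
    rw [hit m ⟨e b, Set.mem_range_self b⟩]
    exact Subtype.property _
  · have h := hit (m + 1) ⟨a, ha⟩
    rw [Function.iterate_succ_apply, hm] at h
    exact h

variable (L B) in
/-- Polymorphisms that are idempotent on a set `A` containing their values, and an endomorphism
into `A`. -/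
structure CoreOps where
  A : Set B
  nonempty : A.Nonempty
  e : B → B
  e_endo : IsEndo L e
  e_mem : ∀ b, e b ∈ A
  p : (Fin 3 → B) → B
  p_pol : p ∈ Pol L B 3
  p_mem : ∀ x, p x ∈ A
  p_right : ∀ x ∈ A, ∀ y ∈ A, p ![x, y, y] = x
  p_left : ∀ x ∈ A, ∀ y ∈ A, p ![y, y, x] = x
  s : ∀ n, (Fin (n + 1) → B) → B
  s_pol : ∀ n, s n ∈ Pol L B (n + 1)
  s_mem : ∀ n x, s n x ∈ A
  s_const : ∀ n, ∀ x ∈ A, s n (fun _ => x) = x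
  s_perm : ∀ n, IsFullySymmetric (s n)

theorem nonempty_coreOps [L.IsRelational] [Finite B] [Nonempty B]
    (hMaltsev : ∃ f ∈ Pol L B 3, IsQuasiMaltsev f)
    (hSymm : ∀ n : ℕ, 0 < n → ∃ f ∈ Pol L B n, IsFullySymmetric f) : Nonempty (CoreOps L B) := by
  obtain ⟨A, hA, hinv⟩ := exists_core L B
  obtain ⟨e, he, heA, -⟩ := hinv id isEndo_id
  have idem : ∀ {n : ℕ} (f : (Fin n → B) → B), f ∈ Pol L B n →
      ∃ g : B → B, g ∘ f ∈ Pol L B n ∧ (∀ b, g b ∈ A) ∧ ∀ a ∈ A, g (f fun _ => a) = a := by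
    intro n f hf
    obtain ⟨g, hg, hgA, hgf⟩ := hinv _ (isEndo_diag hf)
    exact ⟨g, hg.comp_mem_Pol hf, hgA, hgf⟩
  obtain ⟨p, hp, hpm⟩ := hMaltsev
  obtain ⟨g, hg, hgA, hgp⟩ := idem p hp
  choose s hs hsym using fun n => hSymm (n + 1) n.succ_pos
  choose g' hg' hgA' hgs using fun n => idem (s n) (hs n)
  have hconst : ∀ x : B, ![x, x, x] = fun _ => x := by
    intro x
    funext i
    fin_cases i <;> rfl
  exact ⟨{
    A := A
    nonempty := hA
    e := e
    e_endo := he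
    e_mem := heA
    p := g ∘ p
    p_pol := hg
    p_mem := fun _ => hgA _
    p_right := fun x hx y _ => by
      rw [Function.comp_apply, ← (hpm x y).1, hconst, hgp x hx]
    p_left := fun x hx y _ => by
      rw [Function.comp_apply, ← (hpm x y).2, ← (hpm x y).1, hconst, hgp x hx]
    s := fun n => g' n ∘ s n
    s_pol := hg'
    s_mem := fun n _ => hgA' n _
    s_const := hgs
    s_perm := fun n π x => congrArg (g' n) (hsym n π x) }⟩

namespace CoreOps

variable (C : CoreOps L B)

instance : SymMaltsev C.A where
  p x y z := ⟨C.p ![x, y, z], C.p_mem _⟩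
  s n x := ⟨C.s n fun i => x i, C.s_mem _ _⟩
  p_right x y := Subtype.ext (C.p_right x x.2 y y.2)
  p_left x y := Subtype.ext (C.p_left x x.2 y y.2)
  s_const n x := Subtype.ext (C.s_const n x x.2)
  s_perm n π x := Subtype.ext (C.s_perm n π fun i => x i)

/-- The restriction of a relation to `A`. -/
def Rel {k : ℕ} (R : L.Relations k) : Type w :=
  {r : Fin k → C.A // RelMap R fun i => (r i : B)}

instance [L.IsRelational] {k : ℕ} (R : L.Relations k) : SymMaltsev (C.Rel R) where
  p x y z := ⟨fun i => SymMaltsev.p (x.1 i) (y.1 i) (z.1 i), by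
    refine mem_Pol_iff.1 C.p_pol k R (fun i => ![x.1 i, y.1 i, z.1 i]) fun i => ?_
    fin_cases i
    exacts [x.2, y.2, z.2]⟩
  s n x := ⟨fun i => SymMaltsev.s n fun j => (x j).1 i,
    mem_Pol_iff.1 (C.s_pol n) k R (fun i j => (x j).1 i) fun j => (x j).2⟩
  p_right x y := Subtype.ext (funext fun _ => SymMaltsev.p_right _ _)
  p_left x y := Subtype.ext (funext fun _ => SymMaltsev.p_left _ _)
  s_const n x := Subtype.ext (funext fun _ => SymMaltsev.s_const _ _)
  s_perm n π x := Subtype.ext (funext fun i => SymMaltsev.s_perm n π fun j => (x j).1 i)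

instance [Finite B] {k : ℕ} (R : L.Relations k) : Finite (C.Rel R) :=
  inferInstanceAs (Finite {r : Fin k → C.A // RelMap R fun i => (r i : B)})

/-! ### The pp-power of `P₁` -/

/-- The relation on `Set A → P₁` that consists of the tuples satisfying all equalities and all
unary conditions that hold for the characteristic functions of the tuples in `R`. -/
structure IsHull {k : ℕ} (R : L.Relations k) (x : Fin k → Set C.A → P₁) : Prop where
  nonempty : Nonempty (C.Rel R)
  eq : ∀ i j S T, (∀ r : C.Rel R, r.1 i ∈ S ↔ r.1 j ∈ T) → x i S = x j T
  target : ∀ i S, (∀ r : C.Rel R, r.1 i ∈ S) → x i S = .target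
  source : ∀ i S, (∀ r : C.Rel R, r.1 i ∉ S) → x i S = .source

open scoped Classical in
/-- The characteristic function of (the image in `A` of) an element. -/
noncomputable def char (b : B) : Set C.A → P₁ :=
  fun S => if ⟨C.e b, C.e_mem b⟩ ∈ S then .target else .source

open scoped Classical in
theorem isHull_char {k : ℕ} {R : L.Relations k} {b : Fin k → B} (hb : RelMap R b) :
    C.IsHull R fun i => C.char (b i) := by
  let r : C.Rel R := ⟨fun i => ⟨C.e (b i), C.e_mem _⟩, C.e_endo k R b hb⟩
  exact ⟨⟨r⟩, fun i j S T h => if_congr (h r) rfl rfl, fun i S h => if_pos (h r),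
    fun i S h => if_neg (h r)⟩

/-- Preserving the single edge forces `f` to be idempotent, and the hull is cut out by equalities
and constants only. -/
theorem IsHull.map {C : CoreOps L B} {k n : ℕ} {R : L.Relations k} (hn : 0 < n)
    {x : Fin n → Fin k → Set C.A → P₁} (hx : ∀ l, C.IsHull R (x l)) {f : (Fin n → P₁) → P₁}
    (hf : f ∈ Pol FirstOrder.Language.graph P₁ n) :
    C.IsHull R fun i S => f fun l => x l i S := by
  obtain ⟨hs, ht⟩ : f (fun _ => .source) = .source ∧ f (fun _ => .target) = .target :=
    mem_Pol_iff.1 hf 2 FirstOrder.Language.adj ![fun _ => .source, fun _ => .target]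
      fun _ => ⟨rfl, rfl⟩
  refine ⟨(hx ⟨0, hn⟩).nonempty, fun i j S T h => ?_, fun i S h => ?_, fun i S h => ?_⟩
  · exact congrArg f (funext fun l => (hx l).eq i j S T h)
  · rw [← ht]
    exact congrArg f (funext fun l => (hx l).target i S h)
  · rw [← hs]
    exact congrArg f (funext fun l => (hx l).source i S h)

variable [Finite B]

/-- The algebra on `A` with the family given by a Boolean function. -/
def famAlg (y : Set C.A → P₁) (h : y ∅ = .source ∧ y Set.univ = .target) : FamAlg.{w} where
  carrier := C.A
  fam := {S | y S = .target}
  empty_notMem h' := by simp [h.1] at h'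
  univ_mem := h.2

open scoped Classical in
/-- The homomorphism from the pp-power of `P₁` to `B`. -/
noncomputable def eval (y : Set C.A → P₁) : B :=
  if h : y ∅ = .source ∧ y Set.univ = .target then
    Subtype.val (p := (· ∈ C.A)) (C.famAlg y h).point
  -- An arbitrary value: coordinates of tuples in a hull never reach this case.
  else C.nonempty.some

/-- The algebra on a relation with the family given by an element of its hull. -/
def relFamAlg [L.IsRelational] {k : ℕ} {R : L.Relations k} {x : Fin k → Set C.A → P₁}
    (hx : C.IsHull R x) : FamAlg.{w} where
  carrier := C.Rel R
  -- `Set.univ` is listed separately because a relation of arity zero has no coordinates.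
  fam := {U | U = Set.univ ∨ ∃ i S, U = {r : C.Rel R | r.1 i ∈ S} ∧ x i S = .target}
  empty_notMem := by
    rintro (h | ⟨i, S, h, hi⟩)
    · have := hx.nonempty
      exact Set.empty_ne_univ h
    · rw [hx.source i S fun r hr => (h.ge hr : r ∈ (∅ : Set (C.Rel R)))] at hi
      cases hi
  univ_mem := Or.inl rfl

/-- The equality and target conditions of the hull say exactly what is needed for each projection to
push the family on `R` forward to that of its coordinate; naturality of points then applies. -/
theorem relMap_eval [L.IsRelational] {k : ℕ} {R : L.Relations k} {x : Fin k → Set C.A → P₁}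
    (hx : C.IsHull R x) : RelMap R fun i => C.eval (x i) := by
  have hi : ∀ i, x i ∅ = .source ∧ x i Set.univ = .target := fun i =>
    ⟨hx.source i _ fun _ h => h, hx.target i _ fun _ => trivial⟩
  have hproj : ∀ i, FamAlg.IsHom (X := C.relFamAlg hx) (Y := C.famAlg (x i) (hi i))
      fun r : C.Rel R => r.1 i := by
    refine fun i => ⟨fun _ _ _ => rfl, fun _ _ => rfl, fun T => ⟨fun h => Or.inr ⟨i, T, rfl, h⟩, ?_⟩⟩
    rintro (h | ⟨j, S, h, hj⟩)
    · exact hx.target i T fun r => h.ge (Set.mem_univ r)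
    · exact (hx.eq i j T S fun r => Set.ext_iff.1 h r).trans hj
  let r : C.Rel R := (C.relFamAlg hx).point
  have hr : (fun i => C.eval (x i)) = fun i => (r.1 i : B) := by
    funext i
    rw [eval, dif_pos (hi i)]
    exact congrArg Subtype.val (hproj i).map_point.symm
  rw [hr]
  exact r.2

/-- The minion homomorphism from `Pol(P₁)`. -/
noncomputable def minionHom [L.IsRelational] : MinionHom FirstOrder.Language.graph P₁ L B where
  toFun _ hn f := ⟨fun c => C.eval fun S => f.1 fun l => C.char (c l) S,
    mem_Pol_iff.2 fun _ _ _ hx =>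
      C.relMap_eval (IsHull.map hn (fun l => C.isHull_char (hx l)) f.2)⟩
  map_minor _ _ _ _ _ _ := rfl

end CoreOps

end Core

/-! ### Primitive positive definability -/

section PPDefinable

variable {L : FirstOrder.Language.{u, v}} {A : Type w} [L.Structure A] {α : Type w'}

open FirstOrder.Language (BoundedFormula Term)

theorem ppDefinable_empty : PPDefinable L A (∅ : Set (α → A)) :=
  ⟨⊥, .falsum, by ext; simp⟩

theorem ppDefinable_univ [Nonempty A] : PPDefinable L A (Set.univ : Set (α → A)) :=
  -- Truth is not a constructor of `IsPP`, and `α` may be empty, so a trivial equality of a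
  -- quantified variable is used.
  ⟨(Term.bdEqual (.var (Sum.inr 0)) (.var (Sum.inr 0)) : L.BoundedFormula α 1).ex,
    .ex (.atomic (.equal _ _)), by ext; simp [FirstOrder.Language.Formula.Realize]⟩

theorem ppDefinable_eq (a b : α) : PPDefinable L A {x : α → A | x a = x b} :=
  ⟨(Term.bdEqual (.var (Sum.inl a)) (.var (Sum.inl b)) : L.BoundedFormula α 0),
    .atomic (.equal _ _), by ext; simp [FirstOrder.Language.Formula.Realize]⟩

theorem PPDefinable.inter {S T : Set (α → A)} (hS : PPDefinable L A S) (hT : PPDefinable L A T) :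
    PPDefinable L A (S ∩ T) := by
  obtain ⟨φ, hφ, rfl⟩ := hS
  obtain ⟨ψ, hψ, rfl⟩ := hT
  exact ⟨φ ⊓ ψ, .inf hφ hψ, by ext; simp⟩

theorem ppDefinable_iInter [Nonempty A] {ι : Type*} [Finite ι] {S : ι → Set (α → A)}
    (hS : ∀ i, PPDefinable L A (S i)) : PPDefinable L A (⋂ i, S i) := by
  classical
  have := Fintype.ofFinite ι
  suffices ∀ t : Finset ι, PPDefinable L A (⋂ i ∈ t, S i) by simpa using this Finset.univ
  intro t
  induction t using Finset.induction_on with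
  | empty => simpa using ppDefinable_univ
  | insert i t _ ih =>
    rw [Finset.set_biInter_insert]
    exact (hS i).inter ih

theorem PPDefinable.imp [Nonempty A] {S : Set (α → A)} (hS : PPDefinable L A S) (P : Prop) :
    PPDefinable L A {x | P → x ∈ S} := by
  by_cases hP : P
  · simpa [hP] using hS
  · simpa [hP] using ppDefinable_univ

open FirstOrder.Language (graph adj)

instance : Nonempty P₁ := ⟨.source⟩

theorem ppDefinable_source (a : α) : PPDefinable graph P₁ {x : α → P₁ | x a = .source} := by
  refine ⟨(adj.boundedFormula₂ (.var (Sum.inl a)) (.var (Sum.inr 0)) :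
    graph.BoundedFormula α 1).ex, .ex (.atomic (.rel _ _)), ?_⟩
  ext x
  simp only [FirstOrder.Language.Formula.Realize, BoundedFormula.realize_ex,
    BoundedFormula.realize_rel₂]
  exact ⟨fun h => ⟨.target, h, rfl⟩, fun ⟨_, h, _⟩ => h⟩

theorem ppDefinable_target (a : α) : PPDefinable graph P₁ {x : α → P₁ | x a = .target} := by
  refine ⟨(adj.boundedFormula₂ (.var (Sum.inr 0)) (.var (Sum.inl a)) :
    graph.BoundedFormula α 1).ex, .ex (.atomic (.rel _ _)), ?_⟩
  ext x
  simp only [FirstOrder.Language.Formula.Realize, BoundedFormula.realize_ex,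
    BoundedFormula.realize_rel₂]
  exact ⟨fun h => ⟨.source, rfl, h⟩, fun ⟨_, _, h⟩ => h⟩

end PPDefinable

/-- Since `A` is finite there are finitely many conditions, each an equality or a constant. If `R`
has no tuple in `A`, the hull is empty and `⊥` defines it. -/
theorem CoreOps.ppDefinable_isHull {L : FirstOrder.Language.{u, v}} {B : Type w}
    [L.Structure B] [Finite B] (C : CoreOps L B) {k : ℕ} (R : L.Relations k) {α : Type w'}
    (v : Fin k → Set C.A → α) :
    PPDefinable FirstOrder.Language.graph P₁
      {x : α → P₁ | C.IsHull R fun i S => x (v i S)} := by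
  by_cases hR : Nonempty (C.Rel R)
  swap
  · convert ppDefinable_empty using 1
    exact Set.eq_empty_of_forall_notMem fun x hx => hR hx.nonempty
  have h₁ := ppDefinable_iInter fun i => ppDefinable_iInter fun j => ppDefinable_iInter fun S =>
    ppDefinable_iInter fun T => (ppDefinable_eq (L := FirstOrder.Language.graph) (A := P₁)
      (v i S) (v j T)).imp (∀ r : C.Rel R, r.1 i ∈ S ↔ r.1 j ∈ T)
  have h₂ := ppDefinable_iInter fun i => ppDefinable_iInter fun S =>
    (ppDefinable_target (v i S)).imp (∀ r : C.Rel R, r.1 i ∈ S)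
  have h₃ := ppDefinable_iInter fun i => ppDefinable_iInter fun S =>
    (ppDefinable_source (v i S)).imp (∀ r : C.Rel R, r.1 i ∉ S)
  convert (h₁.inter h₂).inter h₃ using 1
  ext x
  simp only [Set.mem_inter_iff, Set.mem_iInter, Set.mem_ofPred_eq]
  exact ⟨fun h => ⟨⟨h.eq, h.target⟩, h.source⟩, fun h => ⟨hR, h.1.1, h.1.2, h.2⟩⟩

theorem CoreOps.ppConstructs {L : FirstOrder.Language.{u, v}} [L.IsRelational] {B : Type w}
    [L.Structure B] [Finite B] (C : CoreOps L B) :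
    PPConstructs FirstOrder.Language.graph P₁ L B := by
  let ε := Finite.equivFin (Set C.A)
  let inst : L.Structure (Fin (Nat.card (Set C.A)) → P₁) :=
    { funMap := fun F => isEmptyElim F
      RelMap := fun R x => C.IsHull R fun i S => x i (ε S) }
  refine ⟨Nat.card (Set C.A), Nat.card_pos, inst,
    fun k R => C.ppDefinable_isHull R fun i S => (i, ε S), ⟨?_⟩, ⟨?_⟩⟩
  · exact
      { toFun := fun y => C.eval fun S => y (ε S)
        map_fun' := fun F => isEmptyElim F
        map_rel' := fun _ _ hx => C.relMap_eval hx }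
  · exact
      { toFun := fun b i => C.char b (ε.symm i)
        map_fun' := fun F => isEmptyElim F
        map_rel' := fun R b hb => by
          change C.IsHull R fun i S => C.char (b i) (ε.symm (ε S))
          simpa using C.isHull_char hb }

end PPConstruct

theorem mainTheorem2 {L : FirstOrder.Language} [L.IsRelational] (B : Type*) [L.Structure B]
    [Finite B] [Nonempty B]
    (hMaltsev : ∃ f ∈ PPConstruct.Pol L B 3, PPConstruct.IsQuasiMaltsev f)
    (hSymm : ∀ n : ℕ, 0 < n → ∃ f ∈ PPConstruct.Pol L B n, PPConstruct.IsFullySymmetric f) :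
    PPConstruct.PPConstructs FirstOrder.Language.graph PPConstruct.P₁ L B ∧
      Nonempty (PPConstruct.MinionHom FirstOrder.Language.graph PPConstruct.P₁ L B) := by
  obtain ⟨C⟩ := PPConstruct.nonempty_coreOps hMaltsev hSymm
  exact ⟨C.ppConstructs, ⟨C.minionHom⟩⟩
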